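/- Theorem 3.1 (Representation as a supremum). Let $(\Omega,\mathcal F,P)$ be a probability space and let $\sigma\colon(0,1)\to[0,\infty)$ be non-decreasing with $\int_0^1\sigma(u)\,\mathrm du=1$. For $Y\in L^1(P)$ put $\mathrm{VaR}_p(Y)=F_Y^{-1}(p)=\inf\{y\in\mathbb R\colon P(Y\le y)\ge p\}$ for $0<p<1$, $\mathrm{AVaR}_\alpha(Y)=\frac1{1-\alpha}\int_\alpha^1\mathrm{VaR}_p(Y)\,\mathrm dp$ for $0\le\alpha<1$, $\mathrm{AVaR}_1(Y)=\operatorname{ess\,sup}Y$, and let $$\mathcal R_\sigma(Y)=\int_0^1F_Y^{-1}(u)\,\sigma(u)\,\mathrm du$$ be the spectral risk measure with spectrum $\sigma$. For $Z\in L^1(P)$ write $Z\preccurlyeq\sigma$ ($\sigma$ majorizes $Z$) if $\mathbb EZ=\int_0^1\sigma(p)\,\mathrm dp$ and $(1-\alpha)\,\mathrm{AVaR}_\alpha(Z)\le\int_\alpha^1\sigma(p)\,\mathrm dp$ for all $\alpha\in[0,1]$ (with $0\cdot\infty=0$), and let $$\mathcal R_\sigma^*(Z)=\sup\{\mathbb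 E\,YZ-\mathcal R_\sigma(Y)\colon Y\in L^\infty(P)\}$$ be the convex conjugate. Expectations and integrals take values in $[-\infty,\infty]$, and each supremum of expectations in (i) and (ii) below is over those $Z$, respectively $U$, for which the expectation exists, i.e. for which the positive and the negative part of the integrand are not both of infinite expectation. (i) For every $Y\in L^1(P)$ the integral $\mathcal R_\sigma(Y)$ exists in $(-\infty,\infty]$, and $$\mathcal R_\sigma(Y)=\sup\{\mathbb E\,YZ\colon Z\in L^1(P),\ Z\preccurlyeq\sigma\}=\sup\Big\{\mathbb E\,YZ\colon Z\in L^1(P),\ \mathbb EZ=1,\ (1-\alpha)\,\mathrm{AVaR}_\alpha(Z)\le\int_\alpha^1\sigma(p)\,\mathrm dp\ \text{ for all }0\le\alpha<1\Big\}.$$ Moreover, for every $Z\in L^1(P)$, $\mathcal R_\sigma^*(Z)=0$ if $Z\preccurlyeq\sigma$, and $\mathcal R_\sigma^*(Z)=+\infty$ otherwise. (ii) Suppose that $(\Omega,\mathcal F,P)$ carries a uniformly distributed random variable, i.e. some $U$ with $P(U\le u)=u$ for all $u\in[0,1]$. Then for every $Y\in L^1(P)$ $$\mathcal R_\sigma(Y)=\sup\{\mathbb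 E\,Y\sigma(U)\colon U\text{ uniformly distributed}\}.$$ There is a uniformly distributed $U$ that is comonotone with $Y$ (i.e. $(Y(\omega)-Y(\omega'))(U(\omega)-U(\omega'))\ge0$ for all $\omega,\omega'$ in some set of full measure), and for every such $U$ the expectation $\mathbb E\,Y\sigma(U)$ exists and equals $\mathcal R_\sigma(Y)$, so that the supremum is attained. -/

import Mathlib

open MeasureTheory Set
open scoped ENNReal

noncomputable section

namespace SpectralRisk

/-- The integral `∫ X⁺ dμ - ∫ X⁻ dμ` of a real function, with values in the extended reals.
It is meaningful whenever `IntegralExists μ X` holds, and it is then an element of `[-∞, ∞]`. -/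
def extIntegral {Ω : Type*} [MeasurableSpace Ω] (μ : Measure Ω) (X : Ω → ℝ) : EReal :=
  ((∫⁻ ω, ENNReal.ofReal (X ω) ∂μ : ℝ≥0∞) : EReal) -
    ((∫⁻ ω, ENNReal.ofReal (-X ω) ∂μ : ℝ≥0∞) : EReal)

/-- The integral of `X` exists in `[-∞, ∞]`: its positive and its negative part do not both have
infinite integral. -/
def IntegralExists {Ω : Type*} [MeasurableSpace Ω] (μ : Measure Ω) (X : Ω → ℝ) : Prop :=
  AEMeasurable X μ ∧
    (∫⁻ ω, ENNReal.ofReal (X ω) ∂μ ≠ ∞ ∨ ∫⁻ ω, ENNReal.ofReal (-X ω) ∂μ ≠ ∞)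

/-- The Value-at-Risk (lower quantile) `inf {y | P (Y ≤ y) ≥ p}`. For `0 < p < 1` the set is
non-empty and bounded below; only these levels `p` matter in the integrals below. -/
def VaR {Ω : Type*} [MeasurableSpace Ω] (P : Measure Ω) (Y : Ω → ℝ) (p : ℝ) : ℝ :=
  sInf {y : ℝ | p ≤ P.real {ω | Y ω ≤ y}}

/-- The Average Value-at-Risk at level `α`, `0 ≤ α ≤ 1`; at `α = 1` it is the essential supremum,
which may be infinite. -/
def AVaR {Ω : Type*} [MeasurableSpace Ω] (P : Measure Ω) (Y : Ω → ℝ) (α : ℝ) : EReal :=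
  if α < 1 then ((1 / (1 - α) * ∫ p in α..1, VaR P Y p : ℝ) : EReal)
  else essSup (fun ω => (Y ω : EReal)) P

/-- A spectrum: a non-decreasing probability density on the interval `(0, 1)`. -/
structure IsSpectrum (σ : ℝ → ℝ) : Prop where
  monotoneOn : MonotoneOn σ (Ioo 0 1)
  nonneg : ∀ u ∈ Ioo (0 : ℝ) 1, 0 ≤ σ u
  integrable : IntervalIntegrable σ volume 0 1
  integral_eq_one : ∫ u in (0 : ℝ)..1, σ u = 1

/-- The spectral risk measure `∫₀¹ F_Y⁻¹(u) σ(u) du`, with values in the extended reals. -/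
def riskMeasure {Ω : Type*} [MeasurableSpace Ω] (P : Measure Ω) (σ : ℝ → ℝ) (Y : Ω → ℝ) : EReal :=
  extIntegral (volume.restrict (Ioo (0 : ℝ) 1)) (fun u => VaR P Y u * σ u)

/-- The spectrum `σ` majorizes the (integrable) random variable `Z`. At `α = 1` the product on the
left is `0`, also if the essential supremum is infinite. -/
def Majorizes {Ω : Type*} [MeasurableSpace Ω] (P : Measure Ω) (σ : ℝ → ℝ) (Z : Ω → ℝ) : Prop :=
  Integrable Z P ∧
    (∀ α ∈ Icc (0 : ℝ) 1,
      ((1 - α : ℝ) : EReal) * AVaR P Z α ≤ ((∫ p in α..1, σ p : ℝ) : EReal)) ∧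
    ∫ ω, Z ω ∂P = ∫ p in (0 : ℝ)..1, σ p

/-- The convex conjugate `Z ↦ sup {E YZ - R(Y) | Y ∈ L^∞}` of a functional `R`. -/
def conjugate {Ω : Type*} [MeasurableSpace Ω] (P : Measure Ω) (R : (Ω → ℝ) → EReal)
    (Z : Ω → ℝ) : EReal :=
  sSup {x : EReal | ∃ Y : Ω → ℝ, MemLp Y ∞ P ∧ x = extIntegral P (fun ω => Y ω * Z ω) - R Y}

/-- `U` is uniformly distributed: `P (U ≤ u) = u` for all `u ∈ [0, 1]`. -/
def IsUniform {Ω : Type*} [MeasurableSpace Ω] (P : Measure Ω) (U : Ω → ℝ) : Prop :=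
  AEMeasurable U P ∧ ∀ u ∈ Icc (0 : ℝ) 1, P.real {ω | U ω ≤ u} = u

/-- `Y` and `U` are comonotone: there is a set of full measure on which `U ω < U ω'` implies
`Y ω ≤ Y ω'`, that is, on which `(Y ω - Y ω') * (U ω - U ω')` is never negative. -/
def Comonotone {Ω : Type*} [MeasurableSpace Ω] (P : Measure Ω) (Y U : Ω → ℝ) : Prop :=
  ∃ s ∈ ae P, MonovaryOn Y U s

end SpectralRisk

end

/-!
The key point is to express majorization through events: by `majorizes_iff`, `σ` majorizes `Z` if
and only if `E Z = 1` and `E (Z; A) ≤ ∫_{1 - P(A)}^1 σ` for every event `A`. Indeed the tail integral of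
a monotone `f` satisfies `∫_α^1 f = min_t (t (1 - α) + ∫ (f - t)⁺)`, with minimum at `t = f α`, and
for the quantile function of `Z` the excess `∫ (VaR Z - t)⁺` equals `E (Z - t)⁺`, since the quantile
function has the law of `Z` (`map_VaR`). Conversely, when `Z` has atoms, the event bound is only
available at the probabilities of `{Z > t}` and `{Z ≥ t}`, and concavity of `α ↦ ∫_α^1 σ` fills the
gap between them.

*Upper bound.* A majorized `Z` is nonnegative, hence a probability density. The event bound for
`A = {Y > t}` says that `Y`, under the measure with density `Z`, is stochastically dominated by
the quantile function of `Y` under the measure with density `σ` on the unit interval. The layer-cake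
formula, applied to positive and negative parts separately, gives `E Y Z ≤ R(Y)` without
any truncation (`extIntegral_mul_le_riskMeasure`).

*Attainment.* On an arbitrary probability space, possibly with atoms, take `Z = h ∘ Y`, where `h` is
the Radon-Nikodym derivative of the law of the quantile function under the spectral measure with
respect to the law of `Y` (`exists_majorizes_extIntegral_eq`).

*Conjugate.* If `σ` does not majorize `Z`, then a constant or the indicator of an event makes
`E Y Z - R(Y)` positive, and `R` is positively homogeneous (`conjugate_of_not_majorizes`).

*Uniform variables.* For uniform `U` the variable `σ ∘ U` is majorized by `σ`. If `U` is comonotone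
with `Y`, then `VaR (U) ≤ Y` almost surely; both sides have the same finite mean, so they agree
(`Comonotone.ae_eq_VaR`). Such a `U` is obtained by ranking the outcomes by `Y` and breaking ties by
means of a given uniform `V`, which need not be independent of `Y` (`lexRank`).
-/

noncomputable section

namespace SpectralRisk

variable {Ω : Type*} [MeasurableSpace Ω] {P : Measure Ω}

/-! ### Quantile functions -/

instance isProbabilityMeasure_volume_Ioo :
    IsProbabilityMeasure (volume.restrict (Ioo (0 : ℝ) 1)) :=
  ⟨by simp⟩

/-- The quantile function and the distribution function form a Galois connection; the forward
direction uses that the distribution function is right-continuous. -/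
theorem VaR_le_iff [IsProbabilityMeasure P] {Y : Ω → ℝ} (hY : AEMeasurable Y P) {u t : ℝ}
    (hu : u ∈ Ioo (0 : ℝ) 1) : VaR P Y u ≤ t ↔ u ≤ P.real {ω | Y ω ≤ t} := by
  have : IsProbabilityMeasure (P.map Y) := Measure.isProbabilityMeasure_map hY
  have hF : ∀ y, P.real {ω | Y ω ≤ y} = ProbabilityTheory.cdf (P.map Y) y := fun y => by
    rw [ProbabilityTheory.cdf_eq_real, Measure.real, Measure.real,
      Measure.map_apply_of_aemeasurable hY measurableSet_Iic]
    rfl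
  unfold VaR
  simp only [hF]
  set F := ProbabilityTheory.cdf (P.map Y)
  have hne : {y | u ≤ F y}.Nonempty := by
    obtain ⟨y, hy⟩ := ((ProbabilityTheory.tendsto_cdf_atTop (P.map Y)).eventually
      (lt_mem_nhds hu.2)).exists
    exact ⟨y, hy.le⟩
  have hbdd : BddBelow {y | u ≤ F y} := by
    obtain ⟨y, hy⟩ := ((ProbabilityTheory.tendsto_cdf_atBot (P.map Y)).eventually
      (gt_mem_nhds hu.1)).exists
    refine ⟨y, fun z hz => ?_⟩
    by_contra hlt
    exact absurd (hz.trans (F.mono (not_le.1 hlt).le)) (not_le.2 hy)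
  refine ⟨fun h => ?_, fun h => csInf_le hbdd h⟩
  have key : ∀ s, t < s → u ≤ F s := fun s hs => by
    obtain ⟨y, hy, hys⟩ := exists_lt_of_csInf_lt hne (h.trans_lt hs)
    exact le_trans hy (F.mono hys.le)
  have hcont : Filter.Tendsto F (nhdsWithin t (Ioi t)) (nhds (F t)) :=
    (F.right_continuous t).tendsto.mono_left (nhdsWithin_mono _ Ioi_subset_Ici_self)
  exact ge_of_tendsto hcont (Filter.eventually_of_mem self_mem_nhdsWithin key)

theorem lt_VaR_iff [IsProbabilityMeasure P] {Y : Ω → ℝ} (hY : AEMeasurable Y P) {u t : ℝ}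
    (hu : u ∈ Ioo (0 : ℝ) 1) : t < VaR P Y u ↔ P.real {ω | Y ω ≤ t} < u := by
  simpa using (VaR_le_iff hY hu (t := t)).not

theorem measureReal_lt_VaR_le [IsProbabilityMeasure P] {Y : Ω → ℝ} (hY : AEMeasurable Y P)
    {u : ℝ} (hu : u ∈ Ioo (0 : ℝ) 1) : P.real {ω | Y ω < VaR P Y u} ≤ u := by
  set t := VaR P Y u
  have hpos : ∀ n : ℕ, (0 : ℝ) < 1 / ((n : ℝ) + 1) := fun n => by positivity
  have hU : {ω | Y ω < t} = ⋃ n : ℕ, {ω | Y ω ≤ t - 1 / ((n : ℝ) + 1)} := by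
    ext ω
    simp only [mem_ofPred_eq, mem_iUnion]
    refine ⟨fun h => ?_, fun ⟨n, hn⟩ => hn.trans_lt (sub_lt_self _ (hpos n))⟩
    obtain ⟨n, hn⟩ := exists_nat_one_div_lt (sub_pos.2 h)
    exact ⟨n, by linarith⟩
  have hmon : Monotone fun n : ℕ => {ω | Y ω ≤ t - 1 / ((n : ℝ) + 1)} := by
    intro m n hmn ω hω
    have : 1 / ((n : ℝ) + 1) ≤ 1 / ((m : ℝ) + 1) := by gcongr
    simp only [mem_ofPred_eq] at hω ⊢
    linarith
  refine ENNReal.toReal_le_of_le_ofReal hu.1.le ?_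
  rw [hU, hmon.measure_iUnion]
  refine iSup_le fun n => ?_
  rw [← ofReal_measureReal]
  exact ENNReal.ofReal_le_ofReal ((lt_VaR_iff hY hu).1 (sub_lt_self _ (hpos n))).le

theorem monotoneOn_VaR [IsProbabilityMeasure P] {Y : Ω → ℝ} (hY : AEMeasurable Y P) :
    MonotoneOn (VaR P Y) (Ioo 0 1) := fun _ hu _ hv huv =>
  (VaR_le_iff hY hu).2 (huv.trans ((VaR_le_iff hY hv).1 le_rfl))

theorem aemeasurable_VaR [IsProbabilityMeasure P] {Y : Ω → ℝ} (hY : AEMeasurable Y P) :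
    AEMeasurable (VaR P Y) (volume.restrict (Ioo 0 1)) :=
  aemeasurable_restrict_of_monotoneOn measurableSet_Ioo (monotoneOn_VaR hY)

/-- The quantile function, as a random variable on the unit interval, has the law of `Y`. -/
theorem map_VaR [IsProbabilityMeasure P] {Y : Ω → ℝ} (hY : AEMeasurable Y P) :
    (volume.restrict (Ioo (0 : ℝ) 1)).map (VaR P Y) = P.map Y := by
  have : IsProbabilityMeasure (P.map Y) := Measure.isProbabilityMeasure_map hY
  have := Measure.isProbabilityMeasure_map (aemeasurable_VaR hY)
  refine Measure.ext_of_Iic _ _ fun t => ?_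
  rw [Measure.map_apply_of_aemeasurable hY measurableSet_Iic,
    Measure.map_apply_of_aemeasurable (aemeasurable_VaR hY) measurableSet_Iic,
    Measure.restrict_apply' measurableSet_Ioo]
  have hset : VaR P Y ⁻¹' Iic t ∩ Ioo 0 1 = Ioo 0 1 ∩ Iic (P.real {ω | Y ω ≤ t}) := by
    ext u
    simp only [mem_inter_iff, mem_preimage, mem_Iic]
    exact ⟨fun h => ⟨h.2, (VaR_le_iff hY h.2).1 h.1⟩, fun h => ⟨(VaR_le_iff hY h.1).2 h.2, h.1⟩⟩
  have hae : (Ioo 0 1 ∩ Iic (P.real {ω | Y ω ≤ t}) : Set ℝ) =ᵐ[volume]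
      (Ioc 0 1 ∩ Iic (P.real {ω | Y ω ≤ t}) : Set ℝ) :=
    Ioo_ae_eq_Ioc.inter (ae_eq_refl _)
  rw [hset, measure_congr hae, Ioc_inter_Iic, Real.volume_Ioc, min_eq_right measureReal_le_one,
    sub_zero, ofReal_measureReal]
  rfl

theorem integrable_VaR [IsProbabilityMeasure P] {Y : Ω → ℝ} (hY : Integrable Y P) :
    IntegrableOn (VaR P Y) (Ioo 0 1) := by
  have h : Integrable id (P.map Y) :=
    (integrable_map_measure (by fun_prop) hY.aemeasurable).2 hY
  rw [← map_VaR hY.aemeasurable] at h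
  exact (integrable_map_measure (by fun_prop) (aemeasurable_VaR hY.aemeasurable)).1 h

theorem integral_comp_VaR [IsProbabilityMeasure P] {Y : Ω → ℝ} (hY : AEMeasurable Y P)
    {g : ℝ → ℝ} (hg : Measurable g) :
    ∫ u in Ioo (0 : ℝ) 1, g (VaR P Y u) = ∫ ω, g (Y ω) ∂P := by
  rw [← integral_map hY hg.aestronglyMeasurable, ← map_VaR hY,
    integral_map (aemeasurable_VaR hY) hg.aestronglyMeasurable]

/-! ### Tail integrals and mean excess -/

theorem intervalIntegral_eq_Ioo {f : ℝ → ℝ} {a b : ℝ} (hab : a ≤ b) :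
    ∫ p in a..b, f p = ∫ p in Ioo a b, f p := by
  rw [intervalIntegral.integral_of_le hab, integral_Ioc_eq_integral_Ioo]

theorem integrable_excess [IsFiniteMeasure P] {Z : Ω → ℝ} (hZ : Integrable Z P) (t : ℝ) :
    Integrable (fun ω => max (Z ω - t) 0) P :=
  (hZ.sub (integrable_const t)).pos_part

/-- Relaxation of the tail integral by mean excess over an arbitrary threshold `t`; no monotonicity
is needed. -/
theorem integral_tail_le {f : ℝ → ℝ} (hf : IntegrableOn f (Ioo 0 1)) {a : ℝ}
    (ha : a ∈ Icc (0 : ℝ) 1) (t : ℝ) :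
    ∫ p in a..1, f p ≤ t * (1 - a) + ∫ p in Ioo (0 : ℝ) 1, max (f p - t) 0 := by
  have hsub : Ioo a 1 ⊆ Ioo (0 : ℝ) 1 := Ioo_subset_Ioo_left ha.1
  have hmax := integrable_excess hf t
  have h1 : ∫ p in Ioo a 1, (f p - t) ≤ ∫ p in Ioo a 1, max (f p - t) 0 :=
    integral_mono ((hf.mono_set hsub).sub (integrable_const t))
      (IntegrableOn.mono_set hmax hsub) fun p => le_max_left _ _
  have h2 : ∫ p in Ioo a 1, max (f p - t) 0 ≤ ∫ p in Ioo (0 : ℝ) 1, max (f p - t) 0 :=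
    setIntegral_mono_set hmax (ae_of_all _ fun p => le_max_right _ _) hsub.eventuallyLE
  rw [integral_sub (hf.mono_set hsub) (integrable_const t)] at h1
  have h3 : ∫ _ in Ioo a 1, t = t * (1 - a) := by
    simp [ha.2, mul_comm]
  rw [intervalIntegral_eq_Ioo ha.2]
  linarith

/-- For a monotone function the bound `integral_tail_le` is attained at the level `t = f a`. -/
theorem integral_tail_eq {f : ℝ → ℝ} (hf : IntegrableOn f (Ioo 0 1))
    (hmono : MonotoneOn f (Ioo 0 1)) {a : ℝ} (ha : a ∈ Ioo (0 : ℝ) 1) :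
    ∫ p in a..1, f p = f a * (1 - a) + ∫ p in Ioo (0 : ℝ) 1, max (f p - f a) 0 := by
  have hsub : Ioo a 1 ⊆ Ioo (0 : ℝ) 1 := Ioo_subset_Ioo_left ha.1.le
  have h1 : ∫ p in Ioo (0 : ℝ) 1, max (f p - f a) 0
      = ∫ p in Ioo (0 : ℝ) 1, (Ioo a 1).indicator (fun p => f p - f a) p := by
    refine setIntegral_congr_fun measurableSet_Ioo fun p hp => ?_
    by_cases hpa : a < p
    · simp [indicator_of_mem (show p ∈ Ioo a 1 from ⟨hpa, hp.2⟩), hmono ha hp hpa.le]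
    · have : p ∉ Ioo a 1 := fun h => hpa h.1
      simp [indicator_of_notMem this, hmono hp ha (not_lt.1 hpa)]
  rw [h1, setIntegral_indicator measurableSet_Ioo, inter_eq_right.2 hsub,
    integral_sub (hf.mono_set hsub) (integrable_const _), intervalIntegral_eq_Ioo ha.2.le]
  simp [ha.2.le, mul_comm]

theorem setIntegral_le_excess [IsProbabilityMeasure P] {Z : Ω → ℝ} (hZ : Integrable Z P)
    (A : Set Ω) (t : ℝ) :
    ∫ ω in A, Z ω ∂P ≤ t * P.real A + ∫ ω, max (Z ω - t) 0 ∂P := by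
  have hmax := integrable_excess hZ t
  have h1 : ∫ ω in A, (Z ω - t) ∂P ≤ ∫ ω in A, max (Z ω - t) 0 ∂P :=
    integral_mono (hZ.integrableOn.sub (integrable_const t)) hmax.integrableOn
      fun p => le_max_left _ _
  have h2 : ∫ ω in A, max (Z ω - t) 0 ∂P ≤ ∫ ω, max (Z ω - t) 0 ∂P :=
    setIntegral_le_integral hmax (ae_of_all _ fun p => le_max_right _ _)
  rw [integral_sub hZ.integrableOn (integrable_const t)] at h1
  have h3 : ∫ _ in A, t ∂P = t * P.real A := by simp [mul_comm]
  linarith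

/-- The bound `setIntegral_le_excess` is attained by every event between `{t < Z}` and
`{t ≤ Z}`. -/
theorem setIntegral_eq_excess [IsProbabilityMeasure P] {Z : Ω → ℝ} (hZ : Integrable Z P)
    {A : Set Ω} (hA : NullMeasurableSet A P) {t : ℝ} (hlt : ∀ ω, t < Z ω → ω ∈ A)
    (hle : ∀ ω ∈ A, t ≤ Z ω) :
    ∫ ω in A, Z ω ∂P = t * P.real A + ∫ ω, max (Z ω - t) 0 ∂P := by
  have h1 : (fun ω => max (Z ω - t) 0) = A.indicator (fun ω => Z ω - t) := by
    funext ω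
    by_cases h : ω ∈ A
    · simp [h, hle ω h]
    · simp [h, not_lt.1 (mt (hlt ω) h)]
  rw [h1, integral_indicator₀ hA, integral_sub hZ.integrableOn (integrable_const t)]
  simp [mul_comm]

theorem IsSpectrum.integrableOn {σ : ℝ → ℝ} (hσ : IsSpectrum σ) : IntegrableOn σ (Ioo 0 1) :=
  ((intervalIntegrable_iff_integrableOn_Ioo_of_le zero_le_one).1 hσ.integrable)

theorem mul_AVaR_eq {Z : Ω → ℝ} {α : ℝ} (hα : α < 1) :
    ((1 - α : ℝ) : EReal) * AVaR P Z α = ((∫ p in α..1, VaR P Z p : ℝ) : EReal) := by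
  rw [AVaR, if_pos hα, ← EReal.coe_mul]
  congr 1
  field_simp [(sub_pos.2 hα).ne']

theorem integral_VaR_tail_eq [IsProbabilityMeasure P] {Z : Ω → ℝ} (hZ : Integrable Z P) {α : ℝ}
    (hα : α ∈ Ioo (0 : ℝ) 1) :
    ∫ p in α..1, VaR P Z p = VaR P Z α * (1 - α) + ∫ ω, max (Z ω - VaR P Z α) 0 ∂P := by
  rw [integral_tail_eq (integrable_VaR hZ) (monotoneOn_VaR hZ.aemeasurable) hα,
    integral_comp_VaR hZ.aemeasurable (g := fun z => max (z - VaR P Z α) 0) (by fun_prop)]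

theorem integral_VaR_tail_le [IsProbabilityMeasure P] {Z : Ω → ℝ} (hZ : Integrable Z P) {α : ℝ}
    (hα : α ∈ Icc (0 : ℝ) 1) (t : ℝ) :
    ∫ p in α..1, VaR P Z p ≤ t * (1 - α) + ∫ ω, max (Z ω - t) 0 ∂P := by
  rw [← integral_comp_VaR hZ.aemeasurable (g := fun z => max (z - t) 0) (by fun_prop)]
  exact integral_tail_le (integrable_VaR hZ) hα t

theorem integral_VaR [IsProbabilityMeasure P] {Z : Ω → ℝ} (hZ : Integrable Z P) :
    ∫ p in (0 : ℝ)..1, VaR P Z p = ∫ ω, Z ω ∂P := by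
  rw [intervalIntegral_eq_Ioo zero_le_one]
  exact integral_comp_VaR hZ.aemeasurable (g := fun z => z) measurable_id

/-! ### Majorization through expectations over events -/

/-- `σ` majorizes `Z` if and only if `Z` has the mean of `σ` and the expectation of `Z` over an
event of probability `1 - α` never exceeds the upper tail `∫_α^1 σ`. -/
theorem majorizes_iff [IsProbabilityMeasure P] {σ : ℝ → ℝ} (hσ : IsSpectrum σ) {Z : Ω → ℝ}
    (hZ : Integrable Z P) :
    Majorizes P σ Z ↔ ∫ ω, Z ω ∂P = 1 ∧
      ∀ A, NullMeasurableSet A P → ∫ ω in A, Z ω ∂P ≤ ∫ p in (1 - P.real A)..1, σ p := by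
  constructor
  · rintro ⟨-, hle, hmean⟩
    rw [hσ.integral_eq_one] at hmean
    refine ⟨hmean, fun A hA => ?_⟩
    rcases eq_or_lt_of_le (measureReal_nonneg (μ := P) (s := A)) with h0 | h0
    · rw [← h0, sub_zero, intervalIntegral.integral_same,
        setIntegral_measure_zero _ ((measureReal_eq_zero_iff).1 h0.symm)]
    rcases eq_or_lt_of_le (measureReal_le_one (μ := P) (s := A)) with h1 | h1
    · have hAc : P Aᶜ = 0 := by
        have := probReal_compl_eq_one_sub₀ hA
        rwa [h1, sub_self, measureReal_eq_zero_iff] at this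
      have hsum := integral_add_compl₀ hA hZ
      rw [setIntegral_measure_zero _ hAc, add_zero] at hsum
      rw [hsum, h1, sub_self, hσ.integral_eq_one, hmean]
    · have hα : 1 - P.real A ∈ Ioo (0 : ℝ) 1 := ⟨by linarith, by linarith⟩
      have h := hle _ (Ioo_subset_Icc_self hα)
      rw [mul_AVaR_eq hα.2, EReal.coe_le_coe_iff, integral_VaR_tail_eq hZ hα] at h
      have := setIntegral_le_excess hZ A (VaR P Z (1 - P.real A))
      rw [sub_sub_cancel] at h
      exact this.trans h
  · rintro ⟨hmean, hle⟩
    refine ⟨hZ, fun α hα => ?_, by rw [hmean, hσ.integral_eq_one]⟩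
    rcases eq_or_lt_of_le hα.2 with rfl | h1
    · simp
    rw [mul_AVaR_eq h1, EReal.coe_le_coe_iff]
    rcases eq_or_lt_of_le hα.1 with rfl | h0
    · rw [integral_VaR hZ, hmean, hσ.integral_eq_one]
    have hα' : α ∈ Ioo (0 : ℝ) 1 := ⟨h0, h1⟩
    rw [integral_VaR_tail_eq hZ hα']
    set t := VaR P Z α
    have hSα := integral_tail_eq hσ.integrableOn hσ.monotoneOn hα'
    -- The tail integral of `σ` is concave, with slope `-σ α` at `α`.
    have hconc : ∀ a ∈ Icc (0 : ℝ) 1,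
        ∫ p in a..1, σ p ≤ (∫ p in α..1, σ p) + σ α * (α - a) := fun a ha => by
      have := integral_tail_le hσ.integrableOn ha (σ α)
      linarith
    have hmem : ∀ A : Set Ω, 1 - P.real A ∈ Icc (0 : ℝ) 1 := fun A =>
      ⟨by linarith [measureReal_le_one (μ := P) (s := A)],
        by linarith [measureReal_nonneg (μ := P) (s := A)]⟩
    have hbound : ∀ A, NullMeasurableSet A P → (∀ ω, t < Z ω → ω ∈ A) → (∀ ω ∈ A, t ≤ Z ω) →
        t * (1 - α) + ∫ ω, max (Z ω - t) 0 ∂P ≤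
          (∫ p in α..1, σ p) + (σ α - t) * (α - (1 - P.real A)) := fun A hA h1 h2 => by
      have e1 := setIntegral_eq_excess hZ hA h1 h2
      have e2 := hle A hA
      have e3 := hconc _ (hmem A)
      linarith
    -- Convexity in the probability of the event: one of the two extreme events suffices.
    rcases le_total t (σ α) with hts | hts
    · have hA : NullMeasurableSet {ω | t < Z ω} P :=
        nullMeasurableSet_lt aemeasurable_const hZ.aemeasurable
      have hP : α ≤ 1 - P.real {ω | t < Z ω} := by
        have := (VaR_le_iff hZ.aemeasurable hα').1 (le_refl t)
        have hc := probReal_compl_eq_one_sub₀ hA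
        simp only [compl_ofPred, not_lt] at hc
        rwa [← hc]
      have := hbound _ hA (fun _ h => h) (fun _ h => le_of_lt h)
      nlinarith
    · have hA : NullMeasurableSet {ω | t ≤ Z ω} P :=
        nullMeasurableSet_le aemeasurable_const hZ.aemeasurable
      have hP : 1 - P.real {ω | t ≤ Z ω} ≤ α := by
        have hc := probReal_compl_eq_one_sub₀ hA
        simp only [compl_ofPred, not_le] at hc
        rw [← hc]
        exact measureReal_lt_VaR_le hZ.aemeasurable hα'
      have := hbound _ hA (fun _ h => le_of_lt h) (fun _ h => h)
      nlinarith

/-! ### Changes of measure -/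

/-- The probability measure on the unit interval with density `σ`. -/
def spectralMeasure (σ : ℝ → ℝ) : Measure ℝ :=
  (volume.restrict (Ioo (0 : ℝ) 1)).withDensity fun u => ENNReal.ofReal (σ u)

theorem withDensity_ofReal_apply {X : Ω → ℝ} (hX : Integrable X P) (h0 : 0 ≤ᵐ[P] X) {A : Set Ω}
    (hA : NullMeasurableSet A P) :
    (P.withDensity fun ω => ENNReal.ofReal (X ω)) A = ENNReal.ofReal (∫ ω in A, X ω ∂P) := by
  rw [withDensity_apply₀ _ hA,
    ofReal_integral_eq_lintegral_ofReal hX.integrableOn (ae_restrict_of_ae h0)]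

theorem isProbabilityMeasure_withDensity_ofReal {X : Ω → ℝ} (hX : Integrable X P)
    (h0 : 0 ≤ᵐ[P] X) (h1 : ∫ ω, X ω ∂P = 1) :
    IsProbabilityMeasure (P.withDensity fun ω => ENNReal.ofReal (X ω)) :=
  ⟨by rw [withDensity_ofReal_apply hX h0 nullMeasurableSet_univ, setIntegral_univ, h1,
    ENNReal.ofReal_one]⟩

theorem lintegral_ofReal_mul {X Z : Ω → ℝ} (hX : AEMeasurable X P) (hZ : AEMeasurable Z P)
    (hZ0 : 0 ≤ᵐ[P] Z) :
    ∫⁻ ω, ENNReal.ofReal (X ω * Z ω) ∂P =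
      ∫⁻ ω, ENNReal.ofReal (X ω) ∂(P.withDensity fun ω => ENNReal.ofReal (Z ω)) := by
  rw [lintegral_withDensity_eq_lintegral_mul₀ hZ.ennreal_ofReal hX.ennreal_ofReal]
  refine lintegral_congr_ae (hZ0.mono fun ω hω => ?_)
  simp only [Pi.mul_apply]
  rw [ENNReal.ofReal_mul' hω, mul_comm]

theorem lintegral_ofReal_neg_mul {X Z : Ω → ℝ} (hX : AEMeasurable X P) (hZ : AEMeasurable Z P)
    (hZ0 : 0 ≤ᵐ[P] Z) :
    ∫⁻ ω, ENNReal.ofReal (-(X ω * Z ω)) ∂P =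
      ∫⁻ ω, ENNReal.ofReal (-X ω) ∂(P.withDensity fun ω => ENNReal.ofReal (Z ω)) := by
  rw [← lintegral_ofReal_mul (X := fun ω => -X ω) hX.neg hZ hZ0]
  simp only [neg_mul]

theorem IsSpectrum.ae_nonneg {σ : ℝ → ℝ} (hσ : IsSpectrum σ) :
    0 ≤ᵐ[volume.restrict (Ioo (0 : ℝ) 1)] σ :=
  (ae_restrict_mem measurableSet_Ioo).mono hσ.nonneg

theorem IsSpectrum.integral_Ioo {σ : ℝ → ℝ} (hσ : IsSpectrum σ) :
    ∫ u in Ioo (0 : ℝ) 1, σ u = 1 := by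
  rw [← intervalIntegral_eq_Ioo zero_le_one, hσ.integral_eq_one]

theorem IsSpectrum.isProbabilityMeasure {σ : ℝ → ℝ} (hσ : IsSpectrum σ) :
    IsProbabilityMeasure (spectralMeasure σ) :=
  isProbabilityMeasure_withDensity_ofReal hσ.integrableOn hσ.ae_nonneg hσ.integral_Ioo

theorem aemeasurable_VaR_spectralMeasure [IsProbabilityMeasure P] {Y : Ω → ℝ}
    (hY : AEMeasurable Y P) (σ : ℝ → ℝ) : AEMeasurable (VaR P Y) (spectralMeasure σ) :=
  (aemeasurable_VaR hY).mono_ac (withDensity_absolutelyContinuous _ _)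

theorem spectralMeasure_lt_VaR [IsProbabilityMeasure P] {σ : ℝ → ℝ} (hσ : IsSpectrum σ)
    {Y : Ω → ℝ} (hY : AEMeasurable Y P) (t : ℝ) :
    spectralMeasure σ {u | t < VaR P Y u} =
      ENNReal.ofReal (∫ p in P.real {ω | Y ω ≤ t}..1, σ p) := by
  have hnull : NullMeasurableSet {u | t < VaR P Y u} (volume.restrict (Ioo (0 : ℝ) 1)) :=
    nullMeasurableSet_lt aemeasurable_const (aemeasurable_VaR hY)
  rw [spectralMeasure, withDensity_ofReal_apply hσ.integrableOn hσ.ae_nonneg hnull,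
    Measure.restrict_restrict₀ hnull, intervalIntegral_eq_Ioo measureReal_le_one]
  congr 3
  ext u
  constructor
  · rintro ⟨h, hu⟩
    exact ⟨(lt_VaR_iff hY hu).1 h, hu.2⟩
  · rintro ⟨h, hu⟩
    have hu' : u ∈ Ioo (0 : ℝ) 1 := ⟨measureReal_nonneg.trans_lt h, hu⟩
    exact ⟨(lt_VaR_iff hY hu').2 h, hu'⟩

/-! ### The upper bound -/

/-- Layer-cake formula for the positive part, with strict superlevel sets. -/
theorem lintegral_ofReal_eq_meas_lt {X : Ω → ℝ} (hX : AEMeasurable X P) :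
    ∫⁻ ω, ENNReal.ofReal (X ω) ∂P = ∫⁻ t in Ioi (0 : ℝ), P {ω | t < X ω} := by
  have h := lintegral_eq_lintegral_meas_lt P (f := fun ω => max (X ω) 0)
    (ae_of_all _ fun ω => le_max_right _ _) (hX.max aemeasurable_const)
  simp only [ENNReal.ofReal_max, ENNReal.ofReal_zero, zero_le, sup_of_le_left] at h
  rw [h]
  refine setLIntegral_congr_fun measurableSet_Ioi fun t ht => ?_
  simp [not_lt.2 (le_of_lt (mem_Ioi.1 ht))]

/-- Layer-cake formula for the positive part, with weak superlevel sets. -/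
theorem lintegral_ofReal_eq_meas_le {X : Ω → ℝ} (hX : AEMeasurable X P) :
    ∫⁻ ω, ENNReal.ofReal (X ω) ∂P = ∫⁻ t in Ioi (0 : ℝ), P {ω | t ≤ X ω} := by
  have h := lintegral_eq_lintegral_meas_le P (f := fun ω => max (X ω) 0)
    (ae_of_all _ fun ω => le_max_right _ _) (hX.max aemeasurable_const)
  simp only [ENNReal.ofReal_max, ENNReal.ofReal_zero, zero_le, sup_of_le_left] at h
  rw [h]
  refine setLIntegral_congr_fun measurableSet_Ioi fun t ht => ?_
  simp [not_le.2 (mem_Ioi.1 ht)]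

/-- Stochastic dominance orders the integrals of the positive and of the negative parts. -/
theorem lintegral_ofReal_le_of_tail_le {α β : Type*} [MeasurableSpace α] [MeasurableSpace β]
    {μ : Measure α} {ν : Measure β} [IsProbabilityMeasure μ] [IsProbabilityMeasure ν]
    {X : α → ℝ} {Y : β → ℝ} (hX : AEMeasurable X μ) (hY : AEMeasurable Y ν)
    (h : ∀ t, μ {a | t < X a} ≤ ν {b | t < Y b}) :
    ∫⁻ a, ENNReal.ofReal (X a) ∂μ ≤ ∫⁻ b, ENNReal.ofReal (Y b) ∂ν ∧
      ∫⁻ b, ENNReal.ofReal (-Y b) ∂ν ≤ ∫⁻ a, ENNReal.ofReal (-X a) ∂μ := by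
  constructor
  · rw [lintegral_ofReal_eq_meas_lt hX, lintegral_ofReal_eq_meas_lt hY]
    exact lintegral_mono fun t => h t
  · rw [lintegral_ofReal_eq_meas_le (X := fun a => -X a) hX.neg,
      lintegral_ofReal_eq_meas_le (X := fun b => -Y b) hY.neg]
    refine lintegral_mono fun t => ?_
    have hX' : {a | t ≤ -X a} = {a | -t < X a}ᶜ := by
      ext a
      simp only [mem_ofPred_eq, mem_compl_iff, not_lt]
      exact le_neg
    have hY' : {b | t ≤ -Y b} = {b | -t < Y b}ᶜ := by
      ext b
      simp only [mem_ofPred_eq, mem_compl_iff, not_lt]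
      exact le_neg
    rw [hX', hY', prob_compl_eq_one_sub₀ (nullMeasurableSet_lt aemeasurable_const hX),
      prob_compl_eq_one_sub₀ (nullMeasurableSet_lt aemeasurable_const hY)]
    exact tsub_le_tsub_left (h (-t)) 1

theorem Majorizes.integral_eq_one {σ : ℝ → ℝ} (hσ : IsSpectrum σ) {Z : Ω → ℝ}
    (hZ : Majorizes P σ Z) : ∫ ω, Z ω ∂P = 1 := by
  rw [hZ.2.2, hσ.integral_eq_one]

/-- A variable majorized by a nonnegative spectrum is nonnegative, hence a probability density. -/
theorem Majorizes.ae_nonneg [IsProbabilityMeasure P] {σ : ℝ → ℝ} (hσ : IsSpectrum σ) {Z : Ω → ℝ}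
    (hZ : Majorizes P σ Z) : 0 ≤ᵐ[P] Z := by
  obtain ⟨hmean, hle⟩ := (majorizes_iff hσ hZ.1).1 hZ
  refine ae_nonneg_of_forall_setIntegral_nonneg hZ.1 fun A hA _ => ?_
  -- The complement carries at most `∫_{P(A)}^1 σ`, which does not exceed the total mass `1`.
  have h1 := hle Aᶜ hA.compl.nullMeasurableSet
  have h2 := integral_add_compl hA hZ.1
  rw [probReal_compl_eq_one_sub hA, sub_sub_cancel, intervalIntegral_eq_Ioo measureReal_le_one]
    at h1
  have h3 : ∫ p in Ioo (P.real A) 1, σ p ≤ ∫ p in Ioo (0 : ℝ) 1, σ p :=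
    setIntegral_mono_set hσ.integrableOn hσ.ae_nonneg
      (Ioo_subset_Ioo_left measureReal_nonneg).eventuallyLE
  rw [hσ.integral_Ioo] at h3
  linarith

theorem lintegral_ofReal_VaR_mul [IsProbabilityMeasure P] {σ : ℝ → ℝ} (hσ : IsSpectrum σ)
    {Y : Ω → ℝ} (hY : AEMeasurable Y P) :
    ∫⁻ u in Ioo (0 : ℝ) 1, ENNReal.ofReal (VaR P Y u * σ u) =
      ∫⁻ u, ENNReal.ofReal (VaR P Y u) ∂(spectralMeasure σ) :=
  lintegral_ofReal_mul (aemeasurable_VaR hY) hσ.integrableOn.aemeasurable hσ.ae_nonneg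

theorem lintegral_ofReal_neg_VaR_mul [IsProbabilityMeasure P] {σ : ℝ → ℝ} (hσ : IsSpectrum σ)
    {Y : Ω → ℝ} (hY : AEMeasurable Y P) :
    ∫⁻ u in Ioo (0 : ℝ) 1, ENNReal.ofReal (-(VaR P Y u * σ u)) =
      ∫⁻ u, ENNReal.ofReal (-VaR P Y u) ∂(spectralMeasure σ) :=
  lintegral_ofReal_neg_mul (aemeasurable_VaR hY) hσ.integrableOn.aemeasurable hσ.ae_nonneg

/-- Under the change of measure with density `Z`, the law of `Y` is stochastically dominated by the
law of the quantile function of `Y` under the spectral measure. -/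
theorem extIntegral_mul_le_riskMeasure [IsProbabilityMeasure P] {σ : ℝ → ℝ} (hσ : IsSpectrum σ)
    {Y Z : Ω → ℝ} (hY : AEMeasurable Y P) (hZ : Majorizes P σ Z) :
    extIntegral P (fun ω => Y ω * Z ω) ≤ riskMeasure P σ Y := by
  have hZ0 := hZ.ae_nonneg hσ
  have := isProbabilityMeasure_withDensity_ofReal hZ.1 hZ0 (hZ.integral_eq_one hσ)
  have := hσ.isProbabilityMeasure
  have hdom := lintegral_ofReal_le_of_tail_le
    (hY.mono_ac (withDensity_absolutelyContinuous P fun ω => ENNReal.ofReal (Z ω)))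
    (aemeasurable_VaR_spectralMeasure hY σ) fun t => by
      have hA : NullMeasurableSet {ω | t < Y ω} P := nullMeasurableSet_lt aemeasurable_const hY
      have hP : P.real {ω | Y ω ≤ t} = 1 - P.real {ω | t < Y ω} := by
        rw [← probReal_compl_eq_one_sub₀ hA]
        simp only [compl_ofPred, not_lt]
      rw [spectralMeasure_lt_VaR hσ hY, withDensity_ofReal_apply hZ.1 hZ0 hA, hP]
      exact ENNReal.ofReal_le_ofReal (((majorizes_iff hσ hZ.1).1 hZ).2 _ hA)
  rw [riskMeasure, extIntegral, extIntegral, lintegral_ofReal_VaR_mul hσ hY,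
    lintegral_ofReal_neg_VaR_mul hσ hY, lintegral_ofReal_mul hY hZ.1.aemeasurable hZ0,
    lintegral_ofReal_neg_mul hY hZ.1.aemeasurable hZ0]
  exact EReal.sub_le_sub (EReal.coe_ennreal_le_coe_ennreal_iff.2 hdom.1)
    (EReal.coe_ennreal_le_coe_ennreal_iff.2 hdom.2)

/-! ### Existence of the risk measure and attainment of the bound -/

theorem lintegral_ofReal_neg_VaR_mul_ne_top [IsProbabilityMeasure P] {σ : ℝ → ℝ}
    (hσ : IsSpectrum σ) {Y : Ω → ℝ} (hY : Integrable Y P) :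
    ∫⁻ u in Ioo (0 : ℝ) 1, ENNReal.ofReal (-(VaR P Y u * σ u)) ≠ ∞ := by
  have hhalf : (1 / 2 : ℝ) ∈ Ioo (0 : ℝ) 1 := by norm_num
  set c := |VaR P Y (1 / 2)|
  have hint : IntegrableOn (fun u => |VaR P Y u| * σ (1 / 2) + c * σ u) (Ioo 0 1) :=
    ((integrable_VaR hY).abs.mul_const _).add (hσ.integrableOn.const_mul _)
  refine ((lintegral_mono_ae ?_).trans_lt hint.lintegral_lt_top).ne
  filter_upwards [ae_restrict_mem measurableSet_Ioo] with u hu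
  refine ENNReal.ofReal_le_ofReal ?_
  have hσu := hσ.nonneg u hu
  have hσh := hσ.nonneg _ hhalf
  -- On the lower half `σ` is bounded by `σ (1/2)`, on the upper half `VaR` is bounded below.
  rcases le_total u (1 / 2) with h | h
  · have h1 := hσ.monotoneOn hu hhalf h
    have h2 : -(VaR P Y u * σ u) ≤ |VaR P Y u| * σ u := by
      rw [← neg_mul]
      exact mul_le_mul_of_nonneg_right (neg_le_abs _) hσu
    have h3 := mul_le_mul_of_nonneg_left h1 (abs_nonneg (VaR P Y u))
    have h4 : 0 ≤ c * σ u := mul_nonneg (abs_nonneg _) hσu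
    linarith
  · have h1 := monotoneOn_VaR hY.aemeasurable hhalf hu h
    have h2 : -VaR P Y u ≤ c := (neg_le_neg h1).trans (neg_le_abs _)
    have h3 := mul_le_mul_of_nonneg_right h2 hσu
    have h4 : 0 ≤ |VaR P Y u| * σ (1 / 2) := mul_nonneg (abs_nonneg _) hσh
    linarith

/-- The integral defining the risk measure has a negative part of finite integral. -/
theorem riskMeasure_ne_bot [IsProbabilityMeasure P] {σ : ℝ → ℝ} (hσ : IsSpectrum σ)
    {Y : Ω → ℝ} (hY : Integrable Y P) : riskMeasure P σ Y ≠ ⊥ := by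
  have h := lintegral_ofReal_neg_VaR_mul_ne_top hσ hY
  rw [riskMeasure, extIntegral, sub_eq_add_neg, Ne, EReal.add_eq_bot_iff]
  simp [h]

/-- A variable with the mean of `σ` that lies below `σ` in the increasing convex order is
majorized by `σ`. -/
theorem majorizes_of_excess_le [IsProbabilityMeasure P] {σ : ℝ → ℝ} (hσ : IsSpectrum σ)
    {Z : Ω → ℝ} (hZ : Integrable Z P) (hmean : ∫ ω, Z ω ∂P = 1)
    (h : ∀ t, ∫ ω, max (Z ω - t) 0 ∂P ≤ ∫ u in Ioo (0 : ℝ) 1, max (σ u - t) 0) :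
    Majorizes P σ Z := by
  refine ⟨hZ, fun α hα => ?_, by rw [hmean, hσ.integral_eq_one]⟩
  rcases eq_or_lt_of_le hα.2 with rfl | h1
  · simp
  rw [mul_AVaR_eq h1, EReal.coe_le_coe_iff]
  rcases eq_or_lt_of_le hα.1 with rfl | h0
  · rw [integral_VaR hZ, hmean, hσ.integral_eq_one]
  rw [integral_tail_eq hσ.integrableOn hσ.monotoneOn ⟨h0, h1⟩]
  exact (integral_VaR_tail_le hZ hα (σ α)).trans (by linarith [h (σ α)])

theorem map_withDensity_comp {Y : Ω → ℝ} (hY : AEMeasurable Y P) {h : ℝ → ℝ≥0∞}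
    (hh : Measurable h) :
    (P.withDensity fun ω => h (Y ω)).map Y = (P.map Y).withDensity h := by
  ext s hs
  have hY' := hY.mono_ac (withDensity_absolutelyContinuous P fun ω => h (Y ω))
  rw [Measure.map_apply_of_aemeasurable hY' hs, withDensity_apply _ hs,
    withDensity_apply₀ _ (hY.nullMeasurableSet_preimage hs),
    Measure.restrict_map_of_aemeasurable hY hs,
    lintegral_map' hh.aemeasurable hY.restrict]

/-- A density `Z`, a function of `Y`, under which `Y` has the law of its own quantile function under
the spectral measure. It is the Radon-Nikodym derivative of the latter law with respect to the law
of `Y`; on the atoms of `Y` it averages the spectrum. -/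
theorem exists_majorizes_map_eq [IsProbabilityMeasure P] {σ : ℝ → ℝ} (hσ : IsSpectrum σ)
    {Y : Ω → ℝ} (hY : AEMeasurable Y P) :
    ∃ Z : Ω → ℝ, Majorizes P σ Z ∧
      (P.withDensity fun ω => ENNReal.ofReal (Z ω)).map Y =
        (spectralMeasure σ).map (VaR P Y) := by
  have := hσ.isProbabilityMeasure
  have := Measure.isProbabilityMeasure_map hY
  have hq := aemeasurable_VaR hY
  have hq' := aemeasurable_VaR_spectralMeasure hY σ
  have := Measure.isProbabilityMeasure_map hq'
  set ρ := (spectralMeasure σ).map (VaR P Y) with hρ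
  have hac : ρ ≪ P.map Y := by
    refine Measure.AbsolutelyContinuous.mk fun s hs h0 => ?_
    rw [← map_VaR hY, Measure.map_apply_of_aemeasurable hq hs] at h0
    rw [hρ, Measure.map_apply_of_aemeasurable hq' hs]
    exact withDensity_absolutelyContinuous _ _ h0
  set h := ρ.rnDeriv (P.map Y)
  have hh : Measurable h := Measure.measurable_rnDeriv _ _
  have hfin : ∀ᵐ ω ∂P, h (Y ω) < ∞ := ae_of_ae_map hY (Measure.rnDeriv_lt_top ρ (P.map Y))
  let Z : Ω → ℝ := fun ω => (h (Y ω)).toReal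
  have hZm : AEMeasurable Z P := (hh.comp_aemeasurable hY).ennreal_toReal
  have hZ0 : 0 ≤ᵐ[P] Z := ae_of_all _ fun ω => ENNReal.toReal_nonneg
  have hmap : (P.withDensity fun ω => ENNReal.ofReal (Z ω)).map Y = ρ := by
    have : (P.withDensity fun ω => ENNReal.ofReal (Z ω)) = P.withDensity fun ω => h (Y ω) :=
      withDensity_congr_ae (hfin.mono fun ω hω => ENNReal.ofReal_toReal hω.ne)
    rw [this, map_withDensity_comp hY hh, Measure.withDensity_rnDeriv_eq _ _ hac]
  have hY' := hY.mono_ac (withDensity_absolutelyContinuous P fun ω => ENNReal.ofReal (Z ω))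
  have htot : ∫⁻ ω, ENNReal.ofReal (Z ω) ∂P = 1 := by
    have := congrArg (fun m : Measure ℝ => m univ) hmap
    simp only [Measure.map_apply_of_aemeasurable hY' MeasurableSet.univ, measure_univ,
      preimage_univ, withDensity_apply _ MeasurableSet.univ, Measure.restrict_univ] at this
    exact this
  have hZi : Integrable Z P :=
    (lintegral_ofReal_ne_top_iff_integrable hZm.aestronglyMeasurable hZ0).1 (by simp [htot])
  have hmean : ∫ ω, Z ω ∂P = 1 := by
    rw [integral_eq_lintegral_of_nonneg_ae hZ0 hZm.aestronglyMeasurable, htot,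
      ENNReal.toReal_one]
  refine ⟨Z, majorizes_of_excess_le hσ hZi hmean fun t => ?_, hmap⟩
  -- The event `{t < Z}` has the form `Y ∈ B`, so its probability and the integral of `Z` over it
  -- are those of `{VaR ∈ B}` and of `σ` on the unit interval.
  set B : Set ℝ := {x | t < (h x).toReal}
  have hB : MeasurableSet B := measurableSet_lt measurable_const hh.ennreal_toReal
  have hA : NullMeasurableSet (Y ⁻¹' B) P := hY.nullMeasurableSet_preimage hB
  have hA' : NullMeasurableSet (VaR P Y ⁻¹' B) (volume.restrict (Ioo (0 : ℝ) 1)) :=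
    hq.nullMeasurableSet_preimage hB
  have hPA : P.real (Y ⁻¹' B) = (volume.restrict (Ioo (0 : ℝ) 1)).real (VaR P Y ⁻¹' B) := by
    rw [Measure.real, Measure.real, ← Measure.map_apply_of_aemeasurable hY hB,
      ← Measure.map_apply_of_aemeasurable hq hB, map_VaR hY]
  have hint : ∫ ω in Y ⁻¹' B, Z ω ∂P =
      ∫ u in VaR P Y ⁻¹' B, σ u ∂(volume.restrict (Ioo (0 : ℝ) 1)) := by
    have := congrArg (fun m : Measure ℝ => m B) hmap
    simp only [hρ, Measure.map_apply_of_aemeasurable hY' hB,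
      Measure.map_apply_of_aemeasurable hq' hB] at this
    rw [withDensity_ofReal_apply hZi hZ0 hA, spectralMeasure,
      withDensity_ofReal_apply hσ.integrableOn hσ.ae_nonneg hA'] at this
    exact (ENNReal.ofReal_eq_ofReal_iff
      (integral_nonneg_of_ae (ae_restrict_of_ae hZ0))
      (integral_nonneg_of_ae (ae_restrict_of_ae hσ.ae_nonneg))).1 this
  have e1 := setIntegral_eq_excess hZi hA (t := t) (fun ω h => h) (fun ω h => le_of_lt h)
  have e2 := setIntegral_le_excess hσ.integrableOn (VaR P Y ⁻¹' B) t
  rw [← hint, ← hPA] at e2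
  linarith

/-- The supremum in the representation of the risk measure is attained, on every probability
space. -/
theorem exists_majorizes_extIntegral_eq [IsProbabilityMeasure P] {σ : ℝ → ℝ} (hσ : IsSpectrum σ)
    {Y : Ω → ℝ} (hY : Integrable Y P) :
    ∃ Z : Ω → ℝ, Majorizes P σ Z ∧ IntegralExists P (fun ω => Y ω * Z ω) ∧
      extIntegral P (fun ω => Y ω * Z ω) = riskMeasure P σ Y := by
  have hYm := hY.aemeasurable
  obtain ⟨Z, hZ, hmap⟩ := exists_majorizes_map_eq hσ hYm
  have hZ0 := hZ.ae_nonneg hσ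
  have hY' := hYm.mono_ac (withDensity_absolutelyContinuous P fun ω => ENNReal.ofReal (Z ω))
  have key : ∀ g : ℝ → ℝ, Measurable g →
      ∫⁻ ω, ENNReal.ofReal (g (Y ω)) ∂(P.withDensity fun ω => ENNReal.ofReal (Z ω)) =
        ∫⁻ u, ENNReal.ofReal (g (VaR P Y u)) ∂(spectralMeasure σ) := fun g hg => by
    rw [← lintegral_map' (f := fun x => ENNReal.ofReal (g x)) (by fun_prop) hY', hmap,
      lintegral_map' (by fun_prop) (aemeasurable_VaR_spectralMeasure hYm σ)]
  have hpos : ∫⁻ ω, ENNReal.ofReal (Y ω * Z ω) ∂P =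
      ∫⁻ u in Ioo (0 : ℝ) 1, ENNReal.ofReal (VaR P Y u * σ u) := by
    rw [lintegral_ofReal_mul hYm hZ.1.aemeasurable hZ0, lintegral_ofReal_VaR_mul hσ hYm]
    exact key (fun x => x) measurable_id
  have hneg : ∫⁻ ω, ENNReal.ofReal (-(Y ω * Z ω)) ∂P =
      ∫⁻ u in Ioo (0 : ℝ) 1, ENNReal.ofReal (-(VaR P Y u * σ u)) := by
    rw [lintegral_ofReal_neg_mul hYm hZ.1.aemeasurable hZ0, lintegral_ofReal_neg_VaR_mul hσ hYm]
    exact key (fun x => -x) measurable_neg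
  refine ⟨Z, hZ, ⟨hYm.mul hZ.1.aemeasurable, Or.inr ?_⟩, ?_⟩
  · rw [hneg]
    exact lintegral_ofReal_neg_VaR_mul_ne_top hσ hY
  · rw [riskMeasure, extIntegral, extIntegral, hpos, hneg]

/-! ### The convex conjugate -/

theorem extIntegral_of_integrable {X : Ω → ℝ} (hX : Integrable X P) :
    extIntegral P X = ((∫ ω, X ω ∂P : ℝ) : EReal) := by
  have h1 := hX.lintegral_lt_top.ne
  have h2 := hX.neg.lintegral_lt_top.ne
  simp only [Pi.neg_apply] at h2
  rw [integral_eq_lintegral_pos_part_sub_lintegral_neg_part hX, EReal.coe_sub, extIntegral]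
  congr 1
  · rw [← EReal.coe_ennreal_toReal h1]
  · rw [← EReal.coe_ennreal_toReal h2]

theorem VaR_const [IsProbabilityMeasure P] (c : ℝ) {u : ℝ} (hu : u ∈ Ioo (0 : ℝ) 1) :
    VaR P (fun _ => c) u = c := by
  refine eq_of_forall_ge_iff fun t => ?_
  rw [VaR_le_iff aemeasurable_const hu]
  by_cases h : c ≤ t
  · simp [h, hu.2.le]
  · simp [h, hu.1]

theorem riskMeasure_const [IsProbabilityMeasure P] {σ : ℝ → ℝ} (hσ : IsSpectrum σ) (c : ℝ) :
    riskMeasure P σ (fun _ => c) = (c : EReal) := by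
  have hae : (fun u => VaR P (fun _ : Ω => c) u * σ u)
      =ᵐ[volume.restrict (Ioo (0 : ℝ) 1)] fun u => c * σ u := by
    filter_upwards [ae_restrict_mem measurableSet_Ioo] with u hu
    rw [VaR_const c hu]
  rw [riskMeasure, extIntegral_of_integrable ((hσ.integrableOn.const_mul c).congr hae.symm),
    integral_congr_ae hae, integral_const_mul, hσ.integral_Ioo, mul_one]

theorem VaR_indicator_of_le [IsProbabilityMeasure P] {A : Set Ω} (hA : NullMeasurableSet A P)
    {c : ℝ} (hc : 0 < c) {u : ℝ} (hu : u ∈ Ioo (0 : ℝ) 1) (huA : u ≤ 1 - P.real A) :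
    VaR P (A.indicator fun _ => c) u = 0 := by
  have hY : AEMeasurable (A.indicator fun _ => c) P := aemeasurable_const.indicator₀ hA
  refine le_antisymm ((VaR_le_iff hY hu).2 ?_) (not_lt.1 fun h => ?_)
  · rw [← probReal_compl_eq_one_sub₀ hA] at huA
    refine huA.trans (measureReal_mono fun ω hω => ?_)
    simp [indicator_of_notMem hω]
  · have h1 := (VaR_le_iff hY hu).1 le_rfl
    have h2 : {ω | A.indicator (fun _ => c) ω ≤ VaR P (A.indicator fun _ => c) u} = ∅ := by
      ext ω
      simpa using h.trans_le (indicator_nonneg (fun _ _ => hc.le) ω)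
    rw [h2, measureReal_empty] at h1
    exact absurd hu.1 (not_lt.2 h1)

theorem VaR_indicator_of_lt [IsProbabilityMeasure P] {A : Set Ω} (hA : NullMeasurableSet A P)
    {c : ℝ} (hc : 0 < c) {u : ℝ} (hu : u ∈ Ioo (0 : ℝ) 1) (huA : 1 - P.real A < u) :
    VaR P (A.indicator fun _ => c) u = c := by
  have hY : AEMeasurable (A.indicator fun _ => c) P := aemeasurable_const.indicator₀ hA
  refine le_antisymm ((VaR_le_iff hY hu).2 ?_) (not_lt.1 fun h => ?_)
  · have : {ω | A.indicator (fun _ => c) ω ≤ c} = univ :=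
      eq_univ_of_forall fun ω => indicator_le_self' (f := fun _ => c) (fun _ _ => hc.le) ω
    rw [this, probReal_univ]
    exact hu.2.le
  · have h1 := (VaR_le_iff hY hu).1 le_rfl
    refine absurd (h1.trans (measureReal_mono (s₂ := Aᶜ) fun ω hω hωA => ?_)) (not_le.2 ?_)
    · rw [mem_ofPred_eq, indicator_of_mem hωA] at hω
      exact absurd h (not_lt.2 hω)
    · rwa [probReal_compl_eq_one_sub₀ hA]

theorem riskMeasure_indicator [IsProbabilityMeasure P] {σ : ℝ → ℝ} (hσ : IsSpectrum σ)
    {A : Set Ω} (hA : NullMeasurableSet A P) {c : ℝ} (hc : 0 < c) :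
    riskMeasure P σ (A.indicator fun _ => c) =
      ((c * ∫ p in (1 - P.real A)..1, σ p : ℝ) : EReal) := by
  have hle : 1 - P.real A ≤ 1 := by linarith [measureReal_nonneg (μ := P) (s := A)]
  have hsub : Ioo (1 - P.real A) 1 ⊆ Ioo (0 : ℝ) 1 :=
    Ioo_subset_Ioo_left (by linarith [measureReal_le_one (μ := P) (s := A)])
  have hae : (fun u => VaR P (A.indicator fun _ => c) u * σ u)
      =ᵐ[volume.restrict (Ioo (0 : ℝ) 1)]
        (Ioo (1 - P.real A) 1).indicator fun u => c * σ u := by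
    filter_upwards [ae_restrict_mem measurableSet_Ioo] with u hu
    rcases le_or_gt u (1 - P.real A) with h | h
    · rw [VaR_indicator_of_le hA hc hu h, zero_mul, indicator_of_notMem fun h' => not_lt.2 h h'.1]
    · rw [VaR_indicator_of_lt hA hc hu h, indicator_of_mem (show u ∈ Ioo _ _ from ⟨h, hu.2⟩)]
  rw [riskMeasure, extIntegral_of_integrable
    (((hσ.integrableOn.const_mul c).indicator measurableSet_Ioo).congr hae.symm),
    integral_congr_ae hae, integral_indicator measurableSet_Ioo,
    Measure.restrict_restrict measurableSet_Ioo, inter_eq_left.2 hsub, integral_const_mul,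
    intervalIntegral_eq_Ioo hle]

/-- If the gap in the supremum can be any positive multiple of some `d > 0`, the conjugate is
infinite. -/
theorem conjugate_eq_top_of_scaling {R : (Ω → ℝ) → EReal} {Z : Ω → ℝ} {d : ℝ} (hd : 0 < d)
    (h : ∀ c : ℝ, 0 < c → ∃ Y : Ω → ℝ, MemLp Y ∞ P ∧
      extIntegral P (fun ω => Y ω * Z ω) - R Y = ((c * d : ℝ) : EReal)) :
    conjugate P R Z = ⊤ := by
  rw [EReal.eq_top_iff_forall_lt]
  intro x
  obtain ⟨Y, hY, hYd⟩ := h ((|x| + 1) / d) (by positivity)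
  refine lt_of_lt_of_le ?_ (le_sSup ⟨Y, hY, rfl⟩)
  rw [hYd, div_mul_cancel₀ _ hd.ne', EReal.coe_lt_coe_iff]
  linarith [le_abs_self x]

theorem conjugate_of_majorizes [IsProbabilityMeasure P] {σ : ℝ → ℝ} (hσ : IsSpectrum σ)
    {Z : Ω → ℝ} (hZ : Majorizes P σ Z) : conjugate P (riskMeasure P σ) Z = 0 := by
  refine le_antisymm (sSup_le ?_) (le_sSup ⟨fun _ => 0, memLp_const 0, ?_⟩)
  · rintro x ⟨Y, hY, rfl⟩
    exact EReal.sub_nonpos.2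
      (extIntegral_mul_le_riskMeasure hσ hY.aestronglyMeasurable.aemeasurable hZ)
  · simp [riskMeasure_const hσ, extIntegral]

/-- A failure of majorization is detected by a constant or by an event, and positive homogeneity
makes the conjugate infinite. -/
theorem conjugate_of_not_majorizes [IsProbabilityMeasure P] {σ : ℝ → ℝ} (hσ : IsSpectrum σ)
    {Z : Ω → ℝ} (hZ : Integrable Z P) (hnot : ¬ Majorizes P σ Z) :
    conjugate P (riskMeasure P σ) Z = ⊤ := by
  by_cases hmean : ∫ ω, Z ω ∂P = 1
  · have hex : ∃ A, NullMeasurableSet A P ∧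
        ∫ p in (1 - P.real A)..1, σ p < ∫ ω in A, Z ω ∂P := by
      by_contra! hall
      exact hnot ((majorizes_iff hσ hZ).2 ⟨hmean, hall⟩)
    obtain ⟨A, hA, hlt⟩ := hex
    refine conjugate_eq_top_of_scaling (sub_pos.2 hlt) fun c hc =>
      ⟨A.indicator fun _ => c, memLp_top_of_bound
        (aemeasurable_const.indicator₀ hA).aestronglyMeasurable c (ae_of_all _ fun ω => ?_), ?_⟩
    · rw [Real.norm_of_nonneg (indicator_nonneg (fun _ _ => hc.le) ω)]
      exact indicator_le_self' (f := fun _ => c) (fun _ _ => hc.le) ω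
    have hmul : (fun ω => A.indicator (fun _ => c) ω * Z ω) = A.indicator fun ω => c * Z ω := by
      funext ω
      by_cases h : ω ∈ A <;> simp [h]
    rw [riskMeasure_indicator hσ hA hc, hmul,
      extIntegral_of_integrable ((hZ.const_mul c).indicator₀ hA), integral_indicator₀ hA,
      integral_const_mul, ← EReal.coe_sub, mul_sub]
  · set m := ∫ ω, Z ω ∂P
    -- Constants with the sign of `m - 1` detect a wrong mean.
    refine conjugate_eq_top_of_scaling (d := (m - 1) * (m - 1))
      (mul_self_pos.2 (sub_ne_zero.2 hmean)) fun c _ =>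
      ⟨fun _ => c * (m - 1), memLp_const _, ?_⟩
    rw [riskMeasure_const hσ, extIntegral_of_integrable (hZ.const_mul _), integral_const_mul,
      ← EReal.coe_sub]
    congr 1
    change c * (m - 1) * m - c * (m - 1) = _
    ring

/-! ### Uniform and comonotone variables -/

theorem IsUniform.map_eq [IsProbabilityMeasure P] {U : Ω → ℝ} (hU : IsUniform P U) :
    P.map U = volume.restrict (Ioo (0 : ℝ) 1) := by
  have := Measure.isProbabilityMeasure_map hU.1
  refine Measure.ext_of_Iic _ _ fun t => ?_
  have hae : (Iic t ∩ Ioo 0 1 : Set ℝ) =ᵐ[volume] (Ioc 0 (min 1 t) : Set ℝ) := by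
    rw [← Ioc_inter_Iic, inter_comm]
    exact Ioo_ae_eq_Ioc.inter (ae_eq_refl _)
  rw [Measure.map_apply_of_aemeasurable hU.1 measurableSet_Iic,
    Measure.restrict_apply' measurableSet_Ioo, measure_congr hae, Real.volume_Ioc, sub_zero]
  change P {ω | U ω ≤ t} = _
  rw [← ofReal_measureReal]
  rcases le_total t 0 with h0 | h0
  · have h1 : P.real {ω | U ω ≤ t} ≤ P.real {ω | U ω ≤ 0} :=
      measureReal_mono fun ω hω => le_trans hω h0
    rw [hU.2 0 (by simp)] at h1
    rw [ENNReal.ofReal_of_nonpos h1, ENNReal.ofReal_of_nonpos ((min_le_right _ _).trans h0)]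
  rcases le_total t 1 with h1 | h1
  · rw [hU.2 t ⟨h0, h1⟩, min_eq_right h1]
  · have h2 : P.real {ω | U ω ≤ 1} ≤ P.real {ω | U ω ≤ t} :=
      measureReal_mono fun ω hω => le_trans hω h1
    rw [hU.2 1 (by simp)] at h2
    rw [le_antisymm measureReal_le_one h2, min_eq_left h1]

theorem IsUniform.measureReal_lt [IsProbabilityMeasure P] {U : Ω → ℝ} (hU : IsUniform P U)
    {u : ℝ} (hu : u ∈ Ioo (0 : ℝ) 1) : P.real {ω | U ω < u} = u := by
  have h : P {ω | U ω < u} = P.map U (Iio u) :=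
    (Measure.map_apply_of_aemeasurable hU.1 measurableSet_Iio).symm
  have hs : Iio u ∩ Ioo 0 1 = Ioo 0 u := by
    ext x
    simp only [mem_inter_iff, mem_Iio, mem_Ioo]
    exact ⟨fun h => ⟨h.2.1, h.1⟩, fun h => ⟨h.2, h.1, h.2.trans hu.2⟩⟩
  rw [Measure.real, h, hU.map_eq, Measure.restrict_apply' measurableSet_Ioo, hs, Real.volume_Ioo,
    sub_zero, ENNReal.toReal_ofReal hu.1.le]

theorem IsUniform.ae_mem [IsProbabilityMeasure P] {U : Ω → ℝ} (hU : IsUniform P U) :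
    ∀ᵐ ω ∂P, U ω ∈ Ioo (0 : ℝ) 1 := by
  refine ae_of_ae_map hU.1 (p := fun u => u ∈ Ioo (0 : ℝ) 1) ?_
  rw [hU.map_eq]
  exact ae_restrict_mem measurableSet_Ioo

theorem IsUniform.majorizes [IsProbabilityMeasure P] {σ : ℝ → ℝ} (hσ : IsSpectrum σ) {U : Ω → ℝ}
    (hU : IsUniform P U) : Majorizes P σ fun ω => σ (U ω) := by
  have hσ' : Integrable σ (P.map U) := by
    rw [hU.map_eq]
    exact hσ.integrableOn
  refine majorizes_of_excess_le hσ ((integrable_map_measure hσ'.1 hU.1).1 hσ') ?_ fun t => ?_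
  · rw [← integral_map hU.1 hσ'.1, hU.map_eq, hσ.integral_Ioo]
  · have hm := (integrable_excess hσ' t).1
    rw [← integral_map (f := fun x => max (σ x - t) 0) hU.1 hm, hU.map_eq]

/-- A uniform variable `U` comonotone with `Y` satisfies `VaR (U) ≤ Y`, and both sides have the same
law. -/
theorem Comonotone.ae_eq_VaR [IsProbabilityMeasure P] {Y U : Ω → ℝ} (hY : Integrable Y P)
    (hU : IsUniform P U) (hYU : Comonotone P Y U) : Y =ᵐ[P] fun ω => VaR P Y (U ω) := by
  obtain ⟨s, hs, hmono⟩ := hYU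
  have hle : ∀ᵐ ω ∂P, VaR P Y (U ω) ≤ Y ω := by
    filter_upwards [hs, hU.ae_mem] with ω hω hu
    rw [VaR_le_iff hY.aemeasurable hu]
    refine (hU.measureReal_lt hu).ge.trans (ENNReal.toReal_mono (measure_ne_top _ _)
      (measure_mono_ae ?_))
    filter_upwards [hs] with ω' hω' h
    exact hmono hω' hω h
  have hq : Integrable (VaR P Y) (P.map U) := by
    rw [hU.map_eq]
    exact integrable_VaR hY
  have hqU : Integrable (fun ω => VaR P Y (U ω)) P := (integrable_map_measure hq.1 hU.1).1 hq
  have hint : ∫ ω, VaR P Y (U ω) ∂P = ∫ ω, Y ω ∂P := by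
    rw [← integral_map hU.1 hq.1, hU.map_eq,
      integral_comp_VaR hY.aemeasurable (g := fun x => x) measurable_id]
  exact ((integral_eq_iff_of_ae_le hqU hY hle).1 hint).symm

theorem Comonotone.extIntegral_eq [IsProbabilityMeasure P] {σ : ℝ → ℝ} (hσ : IsSpectrum σ)
    {Y U : Ω → ℝ} (hY : Integrable Y P) (hU : IsUniform P U) (hYU : Comonotone P Y U) :
    IntegralExists P (fun ω => Y ω * σ (U ω)) ∧
      extIntegral P (fun ω => Y ω * σ (U ω)) = riskMeasure P σ Y := by
  have hae := hYU.ae_eq_VaR hY hU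
  have hm : AEMeasurable (fun u => VaR P Y u * σ u) (P.map U) := by
    rw [hU.map_eq]
    exact (aemeasurable_VaR hY.aemeasurable).mul hσ.integrableOn.aemeasurable
  have hpos : ∫⁻ ω, ENNReal.ofReal (Y ω * σ (U ω)) ∂P =
      ∫⁻ u in Ioo (0 : ℝ) 1, ENNReal.ofReal (VaR P Y u * σ u) := by
    rw [← hU.map_eq, lintegral_map' hm.ennreal_ofReal hU.1]
    exact lintegral_congr_ae (hae.mono fun ω hω => by simp only [hω])
  have hneg : ∫⁻ ω, ENNReal.ofReal (-(Y ω * σ (U ω))) ∂P =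
      ∫⁻ u in Ioo (0 : ℝ) 1, ENNReal.ofReal (-(VaR P Y u * σ u)) := by
    rw [← hU.map_eq, lintegral_map' (f := fun u => ENNReal.ofReal (-(VaR P Y u * σ u)))
      (hm.neg.ennreal_ofReal) hU.1]
    exact lintegral_congr_ae (hae.mono fun ω hω => by simp only [hω])
  refine ⟨⟨hY.aemeasurable.mul (hU.majorizes hσ).1.aemeasurable, Or.inr ?_⟩, ?_⟩
  · rw [hneg]
    exact lintegral_ofReal_neg_VaR_mul_ne_top hσ hY
  · rw [riskMeasure, extIntegral, extIntegral, hpos, hneg]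

/-! ### Construction of a comonotone uniform variable -/

/-- The event that `(Y, V)` does not exceed `p` in the lexicographic order. -/
def lexBelow {α : Type*} (Y V : α → ℝ) (p : ℝ × ℝ) : Set α :=
  {ω | Y ω < p.1 ∨ Y ω = p.1 ∧ V ω ≤ p.2}

/-- The lexicographic rank of `(Y, V)`: the distribution function of the pair `(Y, V)` for the
lexicographic order, evaluated at the pair itself. It breaks the ties of `Y` by means of `V`. -/
def lexRank (P : Measure Ω) (Y V : Ω → ℝ) (ω : Ω) : ℝ :=
  P.real (lexBelow Y V (Y ω, V ω))

theorem lexBelow_subset_of_mem {α : Type*} {Y V : α → ℝ} {p : ℝ × ℝ} {ω : α}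
    (h : ω ∈ lexBelow Y V p) :
    lexBelow Y V (Y ω, V ω) ⊆ lexBelow Y V p := by
  intro ω' h'
  simp only [lexBelow, mem_ofPred_eq] at h h' ⊢
  grind

theorem subset_lexBelow_of_notMem {α : Type*} {Y V : α → ℝ} {p : ℝ × ℝ} {ω : α}
    (h : ω ∉ lexBelow Y V p) :
    lexBelow Y V p ⊆ lexBelow Y V (Y ω, V ω) := by
  intro ω' h'
  simp only [lexBelow, mem_ofPred_eq] at h h' ⊢
  grind

theorem measurable_lexRank [IsProbabilityMeasure P] {Y V : Ω → ℝ} (hY : Measurable Y)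
    (hV : Measurable V) : Measurable (lexRank P Y V) := by
  have h1 : MeasurableSet {x : (ℝ × ℝ) × Ω | Y x.2 < x.1.1} :=
    measurableSet_lt (by fun_prop) (by fun_prop)
  have h2 : MeasurableSet {x : (ℝ × ℝ) × Ω | Y x.2 = x.1.1} :=
    measurableSet_eq_fun (by fun_prop) (by fun_prop)
  have h3 : MeasurableSet {x : (ℝ × ℝ) × Ω | V x.2 ≤ x.1.2} :=
    measurableSet_le (by fun_prop) (by fun_prop)
  have hs : MeasurableSet {x : (ℝ × ℝ) × Ω | Y x.2 < x.1.1 ∨ Y x.2 = x.1.1 ∧ V x.2 ≤ x.1.2} :=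
    h1.union (h2.inter h3)
  exact ((measurable_measure_prodMk_left (ν := P) hs).comp (hY.prodMk hV)).ennreal_toReal

/-- Since `V` has no atoms, the lexicographic distribution function attains every level. -/
theorem exists_measureReal_lexBelow_eq [IsProbabilityMeasure P] {Y V : Ω → ℝ} (hY : Measurable Y)
    (hVm : Measurable V) (hV : IsUniform P V) {u : ℝ} (hu : u ∈ Ioo (0 : ℝ) 1) :
    ∃ p, P.real (lexBelow Y V p) = u := by
  set y := VaR P Y u
  set f : ℝ → ℝ := fun v => P.real (lexBelow Y V (y, v))
  have hmono : ∀ v w, v ≤ w → f v ≤ f w := fun v w hvw =>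
    measureReal_mono fun ω h => h.imp id fun h => ⟨h.1, h.2.trans hvw⟩
  have hlip : ∀ v ∈ Icc (0 : ℝ) 1, ∀ w ∈ Icc (0 : ℝ) 1, v ≤ w → f w - f v ≤ w - v := by
    intro v hv w hw hvw
    have h1 : f w ≤ f v + P.real ({ω | V ω ≤ w} \ {ω | V ω ≤ v}) := by
      refine (measureReal_mono fun ω h => ?_).trans (measureReal_union_le _ _)
      simp only [lexBelow, mem_union, mem_sdiff, mem_ofPred_eq] at h ⊢
      grind
    have h2 : {ω | V ω ≤ v} ⊆ {ω | V ω ≤ w} := fun ω h => le_trans h hvw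
    rw [measureReal_sdiff h2 (measurableSet_le hVm measurable_const),
      hV.2 w hw, hV.2 v hv] at h1
    linarith
  have hcont : ContinuousOn f (Icc 0 1) := by
    refine (LipschitzOnWith.of_dist_le_mul (K := 1) fun v hv w hw => ?_).continuousOn
    rw [NNReal.coe_one, one_mul, Real.dist_eq, Real.dist_eq]
    rcases le_total v w with h | h
    · rw [abs_sub_comm, abs_sub_comm v, abs_of_nonneg (sub_nonneg.2 (hmono _ _ h)),
        abs_of_nonneg (sub_nonneg.2 h)]
      exact hlip v hv w hw h
    · rw [abs_of_nonneg (sub_nonneg.2 (hmono _ _ h)), abs_of_nonneg (sub_nonneg.2 h)]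
      exact hlip w hw v hv h
  have h0 : f 0 ≤ u := by
    have h1 : f 0 ≤ P.real {ω | Y ω < y} + P.real {ω | V ω ≤ 0} :=
      (measureReal_mono fun ω h => h.imp id fun h => h.2).trans (measureReal_union_le _ _)
    rw [hV.2 0 (by simp), add_zero] at h1
    exact h1.trans (measureReal_lt_VaR_le hY.aemeasurable hu)
  have h1 : u ≤ f 1 := by
    refine le_trans ((VaR_le_iff (P := P) hY.aemeasurable hu).1 (le_refl y)) ?_
    have hm : MeasurableSet {ω | V ω ≤ 1} := measurableSet_le hVm measurable_const
    have h2 : P.real {ω | V ω ≤ 1}ᶜ = 0 := by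
      rw [probReal_compl_eq_one_sub hm, hV.2 1 (by simp),
        sub_self]
    have h3 : P.real {ω | Y ω ≤ y} ≤ f 1 + P.real {ω | V ω ≤ 1}ᶜ := by
      refine (measureReal_mono fun ω h => ?_).trans (measureReal_union_le _ _)
      simp only [lexBelow, mem_union, mem_compl_iff, mem_ofPred_eq] at h ⊢
      grind
    linarith
  obtain ⟨v, -, hv⟩ := intermediate_value_Icc zero_le_one hcont ⟨h0, h1⟩
  exact ⟨(y, v), hv⟩

/-- If the event `lexBelow Y V p` has probability `u`, then it lies between `{lexRank < u}` and
`{lexRank ≤ u}`. -/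
theorem isUniform_lexRank [IsProbabilityMeasure P] {Y V : Ω → ℝ} (hY : Measurable Y)
    (hVm : Measurable V) (hV : IsUniform P V) : IsUniform P (lexRank P Y V) := by
  have hle : ∀ u ∈ Ioo (0 : ℝ) 1, u ≤ P.real {ω | lexRank P Y V ω ≤ u} := fun u hu => by
    obtain ⟨p, hp⟩ := exists_measureReal_lexBelow_eq hY hVm hV hu
    rw [← hp]
    exact measureReal_mono fun ω h => measureReal_mono (lexBelow_subset_of_mem h)
  have hlt : ∀ u ∈ Ioo (0 : ℝ) 1, P.real {ω | lexRank P Y V ω < u} ≤ u := fun u hu => by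
    obtain ⟨p, hp⟩ := exists_measureReal_lexBelow_eq hY hVm hV hu
    rw [← hp]
    refine measureReal_mono fun ω h => ?_
    by_contra hnot
    exact absurd (measureReal_mono (subset_lexBelow_of_notMem hnot)) (not_le.2 h)
  refine ⟨(measurable_lexRank hY hVm).aemeasurable, fun u hu => le_antisymm ?_ ?_⟩
  · by_contra! h
    obtain ⟨w, huw, hw⟩ := exists_between h
    have h1 := hlt w ⟨hu.1.trans_lt huw, hw.trans_le measureReal_le_one⟩
    have h2 : P.real {ω | lexRank P Y V ω ≤ u} ≤ P.real {ω | lexRank P Y V ω < w} :=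
      measureReal_mono fun ω h => lt_of_le_of_lt h huw
    linarith
  · rcases eq_or_lt_of_le hu.1 with rfl | h0
    · exact measureReal_nonneg
    rcases eq_or_lt_of_le hu.2 with rfl | h1
    · have : {ω | lexRank P Y V ω ≤ 1} = univ := eq_univ_of_forall fun ω => measureReal_le_one
      rw [this, probReal_univ]
    · exact hle u ⟨h0, h1⟩

theorem exists_isUniform_comonotone [IsProbabilityMeasure P] {Y V : Ω → ℝ}
    (hY : AEMeasurable Y P) (hV : IsUniform P V) :
    ∃ U : Ω → ℝ, IsUniform P U ∧ Comonotone P Y U := by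
  have hV' : IsUniform P (hV.1.mk V) := by
    refine ⟨hV.1.measurable_mk.aemeasurable, fun u hu => ?_⟩
    refine (measureReal_congr (Filter.eventuallyEq_set.2 ?_)).trans (hV.2 u hu)
    filter_upwards [hV.1.ae_eq_mk] with ω hω
    simp only [← hω]
  refine ⟨lexRank P (hY.mk Y) (hV.1.mk V),
    isUniform_lexRank hY.measurable_mk hV.1.measurable_mk hV',
    {ω | Y ω = hY.mk Y ω}, hY.ae_eq_mk, fun i hi j hj hij => ?_⟩
  rw [mem_ofPred_eq] at hi hj
  rw [hi, hj]
  by_contra! h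
  exact absurd (measureReal_mono (lexBelow_subset_of_mem (p := (hY.mk Y i, hV.1.mk V i))
    (Or.inl h))) (not_le.2 hij)

end SpectralRisk

end

theorem theorem3p1 {Ω : Type*} [MeasurableSpace Ω] (P : Measure Ω) [IsProbabilityMeasure P]
    (σ : ℝ → ℝ) (hσ : SpectralRisk.IsSpectrum σ) :
    (∀ Y : Ω → ℝ, Integrable Y P →
      SpectralRisk.riskMeasure P σ Y ≠ ⊥ ∧
      SpectralRisk.riskMeasure P σ Y =
        sSup {x : EReal | ∃ Z : Ω → ℝ, SpectralRisk.Majorizes P σ Z ∧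
          SpectralRisk.IntegralExists P (fun ω => Y ω * Z ω) ∧
          x = SpectralRisk.extIntegral P (fun ω => Y ω * Z ω)} ∧
      SpectralRisk.riskMeasure P σ Y =
        sSup {x : EReal | ∃ Z : Ω → ℝ, Integrable Z P ∧ ∫ ω, Z ω ∂P = 1 ∧
          (∀ α : ℝ, 0 ≤ α → α < 1 →
            ((1 - α : ℝ) : EReal) * SpectralRisk.AVaR P Z α ≤ ((∫ p in α..1, σ p : ℝ) : EReal)) ∧
          SpectralRisk.IntegralExists P (fun ω => Y ω * Z ω) ∧
          x = SpectralRisk.extIntegral P (fun ω => Y ω * Z ω)}) ∧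
    (∀ Z : Ω → ℝ, Integrable Z P →
      (SpectralRisk.Majorizes P σ Z →
        SpectralRisk.conjugate P (SpectralRisk.riskMeasure P σ) Z = 0) ∧
      (¬ SpectralRisk.Majorizes P σ Z →
        SpectralRisk.conjugate P (SpectralRisk.riskMeasure P σ) Z = ⊤)) ∧
    ((∃ V : Ω → ℝ, SpectralRisk.IsUniform P V) →
      ∀ Y : Ω → ℝ, Integrable Y P →
        SpectralRisk.riskMeasure P σ Y =
          sSup {x : EReal | ∃ U : Ω → ℝ, SpectralRisk.IsUniform P U ∧
            SpectralRisk.IntegralExists P (fun ω => Y ω * σ (U ω)) ∧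
            x = SpectralRisk.extIntegral P (fun ω => Y ω * σ (U ω))} ∧
        (∃ U : Ω → ℝ, SpectralRisk.IsUniform P U ∧ SpectralRisk.Comonotone P Y U) ∧
        (∀ U : Ω → ℝ, SpectralRisk.IsUniform P U → SpectralRisk.Comonotone P Y U →
          SpectralRisk.IntegralExists P (fun ω => Y ω * σ (U ω)) ∧
          SpectralRisk.extIntegral P (fun ω => Y ω * σ (U ω)) =
            SpectralRisk.riskMeasure P σ Y)) := by
  refine ⟨fun Y hY => ?_, fun Z hZ => ⟨SpectralRisk.conjugate_of_majorizes hσ,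
    SpectralRisk.conjugate_of_not_majorizes hσ hZ⟩, fun ⟨V, hV⟩ Y hY => ?_⟩
  · have hsup : SpectralRisk.riskMeasure P σ Y =
        sSup {x : EReal | ∃ Z : Ω → ℝ, SpectralRisk.Majorizes P σ Z ∧
          SpectralRisk.IntegralExists P (fun ω => Y ω * Z ω) ∧
          x = SpectralRisk.extIntegral P (fun ω => Y ω * Z ω)} := by
      refine le_antisymm (le_sSup ?_) (sSup_le ?_)
      · obtain ⟨Z, hZ, hex, heq⟩ := SpectralRisk.exists_majorizes_extIntegral_eq hσ hY
        exact ⟨Z, hZ, hex, heq.symm⟩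
      · rintro x ⟨Z, hZ, -, rfl⟩
        exact SpectralRisk.extIntegral_mul_le_riskMeasure hσ hY.aemeasurable hZ
    refine ⟨SpectralRisk.riskMeasure_ne_bot hσ hY, hsup, hsup.trans ?_⟩
    congr 1
    ext x
    refine exists_congr fun Z => ⟨fun ⟨hZ, hex, hx⟩ => ⟨hZ.1, hZ.integral_eq_one hσ,
      fun α h0 h1 => hZ.2.1 α ⟨h0, h1.le⟩, hex, hx⟩, fun ⟨hi, hmean, hle, hex, hx⟩ =>
      ⟨⟨hi, fun α hα => ?_, by rw [hmean, hσ.integral_eq_one]⟩, hex, hx⟩⟩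
    -- At level `α = 1` both sides of the majorization condition vanish.
    rcases eq_or_lt_of_le hα.2 with rfl | h1
    · simp
    · exact hle α hα.1 h1
  · obtain ⟨U, hU, hYU⟩ := SpectralRisk.exists_isUniform_comonotone hY.aemeasurable hV
    refine ⟨le_antisymm (le_sSup ?_) (sSup_le ?_), ⟨U, hU, hYU⟩,
      fun U hU hYU => hYU.extIntegral_eq hσ hY hU⟩
    · obtain ⟨hex, heq⟩ := hYU.extIntegral_eq hσ hY hU
      exact ⟨U, hU, hex, heq.symm⟩
    · rintro x ⟨U, hU, -, rfl⟩
      exact SpectralRisk.extIntegral_mul_le_riskMeasure hσ hY.aemeasurable (hU.majorizes hσ)
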